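/- Let $M,N\ge 1$, let $\mathcal S$ be a finite set of symbol vectors, all equally likely, and let a space code be given by an injective map $F:\mathcal S\to\mathbb R_{\ge 0}^{N}$ (distinct symbol vectors have distinct codewords with nonnegative entries). The codeword $x=F(s)$ is sent over the $M\times N$ channel $$y=\frac1{P_{op}}Hx+n,\qquad P_{op}=\mathbb E\Big[\sum_{j=1}^N x_j\Big],$$ where the entries of $H$ are independent and log-normal, $h_{ij}=e^{z_{ij}}$ with $z_{ij}\sim\mathcal N(\mu_{ij},\sigma_{ij}^2)$, $\sigma_{ij}>0$, and $n$ is independent of $H$ and has i.i.d. $\mathcal N(0,\sigma_n^2)$ entries. Let $\rho=1/(N\sigma_n^2)$, and for $s\ne\hat s$ let $P(s\to\hat s)$ be the pairwise error probability, averaged over $H$ and $n$, of the maximum likelihood detector that knows $H$: the probability that, when $s$ is sent, $\hat s$ has at least the likelihood of $s$. The code achieves full large-scale diversity if, for all $s\neq\hat s$ in $\mathcal S$, $$\lim_{\rho\to\infty}\frac{-8\ln P(s\to\hat s)}{\ln^2\!\big(\rho/\ln^2\rho\big)}=\Omega:=\sum_{i=1}^M\sum_{j=1}^N\sigma_{ij}^{-2}.$$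 Let $\mathcal E$ be the set of the nonzero error vectors $e=F(\hat s)-F(s)$, $s\neq\hat s$. A vector is unipolar if it does not have two entries of opposite signs. Theorem. The code achieves full large-scale diversity if and only if every $e\in\mathcal E$ is unipolar and has no zero entry; equivalently, if and only if for every $e\in\mathcal E$ all entries of the matrix $X(e)=ee^T$ are positive. -/

import Mathlib

open Filter Topology MeasureTheory ProbabilityTheory
open scoped NNReal Matrix

noncomputable section

namespace MIMOOWC

/-- The log-normal law with parameters `m` and `σ`: the law of `exp z`, where `z` is Gaussian
with mean `m` and variance `σ ^ 2`. -/
def logNormal (m σ : ℝ) : Measure ℝ :=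
  (gaussianReal m (σ ^ 2).toNNReal).map Real.exp

/-- The law of the `M × N` channel matrix: independent log-normal entries
`h i j = exp (z i j)` with `z i j ~ 𝓝(m i j, σ i j ^ 2)`. -/
def channelLaw {M N : ℕ} (m σ : Fin M → Fin N → ℝ) : Measure (Fin M → Fin N → ℝ) :=
  Measure.pi fun i => Measure.pi fun j => logNormal (m i j) (σ i j)

/-- The law of the receiver noise: `M` independent centred Gaussians of variance `v`. -/
def noiseLaw (M : ℕ) (v : ℝ≥0) : Measure (Fin M → ℝ) :=
  Measure.pi fun _ => gaussianReal 0 v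

/-- The noise variance `σₙ²` at signal-to-noise ratio `ρ = 1 / (N σₙ²)`. -/
def noiseVar (N : ℕ) (ρ : ℝ) : ℝ≥0 :=
  (1 / (N * ρ)).toNNReal

/-- The average optical power `E[∑ j, x j]` of the codeword `x = F s`, the symbol vector `s`
being equally likely to be any element of the finite set `S` of symbol vectors. -/
def opticalPower {S : Type*} [Fintype S] {N : ℕ} (F : S → Fin N → ℝ) : ℝ :=
  (∑ s, ∑ j, F s j) / Fintype.card S

/-- The noiseless received vector `(1 / P) H x`. -/
def signal {M N : ℕ} (P : ℝ) (H : Fin M → Fin N → ℝ) (x : Fin N → ℝ) : Fin M → ℝ :=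
  (1 / P) • (Matrix.of H *ᵥ x)

/-- The likelihood of the codeword `x` at the received vector `y`, when the channel matrix is `H`
and the noise variance is `v`: the density at `y` of `(1 / P) H x + n`. -/
def likelihood {M N : ℕ} (P : ℝ) (v : ℝ≥0) (H : Fin M → Fin N → ℝ) (x : Fin N → ℝ)
    (y : Fin M → ℝ) : ℝ :=
  ∏ i, gaussianPDFReal (signal P H x i) v (y i)

/-- The pairwise error probability given the channel matrix `H`, of a maximum likelihood receiver
that knows `H`: the codeword `x` is sent, `y = (1 / P) H x + n` is received, and the codeword `x'`
is at least as likely as `x`. -/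
def condPEP {M N : ℕ} (P : ℝ) (v : ℝ≥0) (H : Fin M → Fin N → ℝ) (x x' : Fin N → ℝ) : ℝ :=
  (noiseLaw M v).real
    {n | likelihood P v H x (signal P H x + n) ≤ likelihood P v H x' (signal P H x + n)}

/-- The average pairwise error probability `P(s → s')` of the space code `F` at signal-to-noise
ratio `ρ`: the mean of the conditional one over the fading. -/
def pep {S : Type*} [Fintype S] {M N : ℕ} (m σ : Fin M → Fin N → ℝ) (F : S → Fin N → ℝ)
    (s s' : S) (ρ : ℝ) : ℝ :=
  ∫ H, condPEP (opticalPower F) (noiseVar N ρ) H (F s) (F s') ∂(channelLaw m σ)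

/-- A function `p` of the signal-to-noise ratio has large-scale diversity gain `g` if
`p ρ = exp (-(g / 8 + o(1)) * (ln (ρ / ln² ρ))²)` as `ρ → ∞`. -/
def HasLargeScaleDiversityGain (p : ℝ → ℝ) (g : ℝ) : Prop :=
  Tendsto (fun ρ => -8 * Real.log (p ρ) / Real.log (ρ / Real.log ρ ^ 2) ^ 2) atTop (𝓝 g)

/-- The total `Ω = ∑ i, ∑ j, σ i j ^ (-2)` of the terms that the channel offers. -/
def totalDiversity {M N : ℕ} (σ : Fin M → Fin N → ℝ) : ℝ :=
  ∑ i, ∑ j, (σ i j ^ 2)⁻¹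

/-- The code `F` achieves full large-scale diversity on the `M × N` channel: the pairwise error
probability of every two distinct symbol vectors has large-scale diversity gain `Ω`. -/
def FullLargeScaleDiversity {S : Type*} [Fintype S] {M N : ℕ} (m σ : Fin M → Fin N → ℝ)
    (F : S → Fin N → ℝ) : Prop :=
  ∀ s s' : S, s ≠ s' → HasLargeScaleDiversityGain (pep m σ F s s') (totalDiversity σ)

/-- The set of the nonzero error vectors `e = F s' - F s`, `s ≠ s'`. -/
def errorSet {S : Type*} {N : ℕ} (F : S → Fin N → ℝ) : Set (Fin N → ℝ) :=
  {e | e ≠ 0 ∧ ∃ s s' : S, s ≠ s' ∧ e = F s' - F s}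

/-- A vector is unipolar if it has no two entries of opposite signs. -/
def IsUnipolar {N : ℕ} (e : Fin N → ℝ) : Prop :=
  (∀ j, 0 ≤ e j) ∨ ∀ j, e j ≤ 0

/-- The matrix `X(e) = e eᵀ`. -/
def errorMatrix {N : ℕ} (e : Fin N → ℝ) : Matrix (Fin N) (Fin N) ℝ :=
  Matrix.vecMulVec e e

end MIMOOWC

end

/-!
Write `e = x' - x` for an error vector, `P` for the optical power and `L = log ρ`. Given `H`, the
pairwise error event is `‖d‖² ≤ 2 ⟪n, d⟫` with `d = (1 / P) H e`, so its probability is at most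
`exp (-‖d‖² / (8 v))` (`condPEP_le`) and is bounded below by a positive constant as soon as
`|d i| ≤ K √v` for all `i` (`le_condPEP`). Here `v` is of order `1 / ρ`, so an error occurs
essentially when every entry of `H e` is of order at most `ρ ^ (-1/2)`.

*Lower bound.* Let `a` be a nonnegative vector with `∑ j, a j * e j = 0`. If `h i j` lies within
`ρ ^ (-1/2)` above `a j` for all `i, j`, then `H e` is that small. For a log-normal `h`, such a
window costs `exp (-L² / (8 σ²) - o(L²))` if `a j = 0`, and only `exp (-o(L²))` if `a j > 0`
(`exists_exp_le_logNormal_Icc`). Hence the diversity gain is at most the sum of `σ i j ^ (-2)` over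
the columns `j` with `a j = 0`. For `a = 0` this is `Ω`. If `e` has a zero entry or two entries of
opposite signs, some nonzero `a ≥ 0` is orthogonal to `e` (`exists_nonneg_sum_mul_eq_zero`), and
the gain is strictly below `Ω`.

*Upper bound.* If `e` is unipolar, then `(∑ j, h i j * e j)² ≥ ∑ j, (h i j * e j)²` because `H` is
nonnegative, so the averaged Chernoff bound is at most the product of the expectations of
`exp (-b j * ρ * h i j ^ 2)`, with `b j > 0` if `e` has no zero entry. Each factor is at most
`exp (-L² / (8 σ²) + o(L²))` (`exists_integral_exp_neg_logNormal_le`).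

All the errors `o(L²)` are of the form `C * (L * √L)`, and they are valid for `ρ ≥ exp 1`, where
`L ≥ 1`. The denominator `ln² (ρ / ln² ρ)` in the diversity gain is equivalent to `L²`.
-/

namespace MIMOOWC

/-! ### Log-normal variables near a point and at the origin -/

theorem log_le_two_mul_sqrt {x : ℝ} (hx : 0 < x) : Real.log x ≤ 2 * √x := by
  have h := Real.log_le_sub_one_of_pos (Real.sqrt_pos.2 hx)
  rw [Real.log_sqrt hx.le] at h
  linarith

theorem le_mul_sqrt_self {x : ℝ} (hx : 1 ≤ x) : x ≤ x * √x :=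
  le_mul_of_one_le_right (by linarith) (Real.one_le_sqrt.2 hx)

theorem one_le_log_of_exp_one_le {ρ : ℝ} (hρ : Real.exp 1 ≤ ρ) : 1 ≤ Real.log ρ :=
  (Real.le_log_iff_exp_le ((Real.exp_pos 1).trans_le hρ)).2 hρ

instance isProbabilityMeasure_logNormal (m σ : ℝ) : IsProbabilityMeasure (logNormal m σ) :=
  Measure.isProbabilityMeasure_map Real.measurable_exp.aemeasurable

instance isProbabilityMeasure_channelLaw {M N : ℕ} (m σ : Fin M → Fin N → ℝ) :
    IsProbabilityMeasure (channelLaw m σ) := by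
  unfold channelLaw; infer_instance

theorem logNormal_real_apply (m σ : ℝ) {s : Set ℝ} (hs : MeasurableSet s) :
    (logNormal m σ).real s = (gaussianReal m (σ ^ 2).toNNReal).real (Real.exp ⁻¹' s) := by
  rw [logNormal, map_measureReal_apply Real.measurable_exp hs]

/-- The Gaussian density is at least its value at distance `D` from the mean on an interval that
stays within that distance. -/
theorem mul_exp_le_gaussianReal_Icc (m : ℝ) {σ u w D : ℝ} (hσ : 0 < σ) (huw : u ≤ w)
    (hD : ∀ z ∈ Set.Icc u w, |z - m| ≤ D) :
    (√(2 * Real.pi * σ ^ 2))⁻¹ * Real.exp (-D ^ 2 / (2 * σ ^ 2)) * (w - u) ≤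
      (gaussianReal m (σ ^ 2).toNNReal).real (Set.Icc u w) := by
  have hv : (σ ^ 2).toNNReal ≠ 0 := (Real.toNNReal_pos.2 (by positivity)).ne'
  have hc : ((σ ^ 2).toNNReal : ℝ) = σ ^ 2 := Real.coe_toNNReal _ (sq_nonneg σ)
  rw [measureReal_def, gaussianReal_apply_eq_integral _ hv,
    ENNReal.toReal_ofReal (integral_nonneg fun _ => gaussianPDFReal_nonneg _ _ _)]
  calc _ = ∫ _ in Set.Icc u w, (√(2 * Real.pi * σ ^ 2))⁻¹ * Real.exp (-D ^ 2 / (2 * σ ^ 2)) := by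
        simp [huw, mul_comm]
    _ ≤ _ := by
        refine setIntegral_mono_on (integrableOn_const measure_Icc_lt_top.ne)
          (integrable_gaussianPDFReal _ _).integrableOn measurableSet_Icc fun z hz => ?_
        rw [gaussianPDFReal, hc]
        have : (z - m) ^ 2 ≤ D ^ 2 := sq_le_sq' (abs_le.1 (hD z hz)).1 (abs_le.1 (hD z hz)).2
        gcongr

/-- The cost of confining a log-normal variable to a window of length `ρ ^ (-1/2)` to the right of
`a`: at `a = 0` it is a Gaussian tail beyond `(log ρ) / 2`, with exponent `(log ρ)² / (8 σ²)`; at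
`a > 0` it is only of the order of the length of the window. -/
theorem exists_exp_le_logNormal_Icc (m : ℝ) {σ a : ℝ} (hσ : 0 < σ) (ha : 0 ≤ a) :
    ∃ C : ℝ, ∀ ρ : ℝ, Real.exp 1 ≤ ρ →
      Real.exp (-((if a = 0 then (σ ^ 2)⁻¹ else 0) / 8) * Real.log ρ ^ 2
          - C * (Real.log ρ * √(Real.log ρ))) ≤
        (logNormal m σ).real (Set.Icc a (a + (√ρ)⁻¹)) := by
  set A : ℝ := (√(2 * Real.pi * σ ^ 2))⁻¹ with hA
  have hApos : 0 < A := by positivity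
  rcases ha.eq_or_lt with rfl | ha
  -- At `a = 0`, keep only the `z` in the unit interval that ends at `log (ρ ^ (-1/2))`.
  · set c := 1 + |m|
    refine ⟨(c + c ^ 2) / (2 * σ ^ 2) + |Real.log A|, fun ρ hρ => ?_⟩
    have hρ0 : 0 < ρ := (Real.exp_pos 1).trans_le hρ
    have hL := one_le_log_of_exp_one_le hρ
    have hL' := le_mul_sqrt_self hL
    have hlog : Real.log (√ρ)⁻¹ = -(Real.log ρ / 2) := by
      rw [Real.log_inv, Real.log_sqrt hρ0.le]
    generalize Real.log ρ = L at *
    rw [logNormal_real_apply _ _ measurableSet_Icc]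
    have hsub : Set.Icc (-(L / 2) - 1) (-(L / 2)) ⊆ Real.exp ⁻¹' Set.Icc 0 (0 + (√ρ)⁻¹) := by
      intro z hz
      refine ⟨(Real.exp_pos z).le, ?_⟩
      rw [zero_add, ← Real.le_log_iff_exp_le (by positivity), hlog]
      exact hz.2
    refine le_trans ?_ (measureReal_mono hsub)
    refine le_trans ?_ (mul_exp_le_gaussianReal_Icc m (D := L / 2 + c) hσ (by linarith) ?_)
    · rw [← hA, ← Real.exp_log hApos, ← Real.exp_add, Real.exp_log hApos]
      simp only [if_true]
      have h1 : -(L / 2) - (-(L / 2) - 1) = 1 := by ring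
      rw [h1, mul_one, Real.exp_le_exp]
      have h2 : -(L / 2 + c) ^ 2 / (2 * σ ^ 2)
          = -((σ ^ 2)⁻¹ / 8) * L ^ 2 - (c * L + c ^ 2) / (2 * σ ^ 2) := by
        field_simp; ring
      have hc : 0 ≤ c := by positivity
      have h3 : (c * L + c ^ 2) / (2 * σ ^ 2) ≤ (c + c ^ 2) / (2 * σ ^ 2) * (L * √L) := by
        rw [div_mul_eq_mul_div]
        gcongr
        nlinarith [sq_nonneg c]
      have h4 : -Real.log A ≤ |Real.log A| * (L * √L) :=
        (neg_le_abs _).trans (le_mul_of_one_le_right (abs_nonneg _) (hL.trans hL'))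
      rw [h2]
      linarith
    · intro z hz
      have := hz.1
      have := hz.2
      rw [abs_le]
      constructor <;> linarith [neg_abs_le m, le_abs_self m]
  -- At `a > 0`, the `z` fill an interval of length at least `ρ ^ (-1/2) / (a + 1)` on which the
  -- density is bounded below independently of `ρ`.
  · set D := |Real.log a| + |Real.log (a + 1)| + |m|
    set K := A * Real.exp (-D ^ 2 / (2 * σ ^ 2)) * (a + 1)⁻¹ with hK
    have hKpos : 0 < K := by positivity
    refine ⟨1 / 2 + |Real.log K|, fun ρ hρ => ?_⟩
    have hρ0 : 0 < ρ := (Real.exp_pos 1).trans_le hρ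
    have hL := one_le_log_of_exp_one_le hρ
    have hL' := le_mul_sqrt_self hL
    have hr0 : 0 < (√ρ)⁻¹ := by positivity
    have hr1 : (√ρ)⁻¹ ≤ 1 := inv_le_one_of_one_le₀
      (Real.one_le_sqrt.2 (le_trans (by linarith [Real.add_one_le_exp 1]) hρ))
    have hlog : Real.log (√ρ)⁻¹ = -(Real.log ρ / 2) := by
      rw [Real.log_inv, Real.log_sqrt hρ0.le]
    generalize Real.log ρ = L at *
    generalize (√ρ)⁻¹ = r at *
    rw [logNormal_real_apply _ _ measurableSet_Icc]
    have hsub : Set.Icc (Real.log a) (Real.log (a + r)) ⊆ Real.exp ⁻¹' Set.Icc a (a + r) :=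
      fun z hz => ⟨(Real.log_le_iff_le_exp ha).1 hz.1,
        (Real.le_log_iff_exp_le (by positivity)).1 hz.2⟩
    refine le_trans ?_ (measureReal_mono hsub)
    refine le_trans ?_ (mul_exp_le_gaussianReal_Icc m (D := D) hσ
      (Real.log_le_log ha (by linarith)) ?_)
    · have h1 : r * (a + 1)⁻¹ ≤ Real.log (a + r) - Real.log a := by
        have h := Real.one_sub_inv_le_log_of_pos (x := (a + r) / a) (by positivity)
        rw [Real.log_div (by positivity) ha.ne'] at h
        refine le_trans ?_ h
        have h5 : 1 - ((a + r) / a)⁻¹ = r * (a + r)⁻¹ := by field_simp; ring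
        rw [h5]
        gcongr
      calc _ ≤ K * r := by
            rw [← Real.exp_log hKpos, ← Real.exp_log hr0, ← Real.exp_add, Real.exp_log hKpos,
              Real.exp_le_exp, hlog, if_neg ha.ne']
            have h4 : -Real.log K ≤ |Real.log K| * (L * √L) :=
              (neg_le_abs _).trans (le_mul_of_one_le_right (abs_nonneg _) (hL.trans hL'))
            linarith
        _ = A * Real.exp (-D ^ 2 / (2 * σ ^ 2)) * (r * (a + 1)⁻¹) := by rw [hK]; ring
        _ ≤ _ := by gcongr
    · intro z hz
      have h1 := hz.1
      have h2 := hz.2.trans (Real.log_le_log (by positivity) (by linarith : a + r ≤ a + 1))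
      rw [abs_le]
      constructor <;> linarith [neg_abs_le m, le_abs_self m, neg_abs_le (Real.log a),
        le_abs_self (Real.log (a + 1)), abs_nonneg (Real.log a), abs_nonneg (Real.log (a + 1))]

/-- The inequality `exp (-u) ≤ (k / u) ^ k`, which replaces the double exponential `exp (-exp (2 z))`
by a moment of the log-normal law. -/
theorem exp_neg_le_exp_mul_log {k u : ℝ} (hk : 0 < k) (hu : 0 < u) :
    Real.exp (-u) ≤ Real.exp (k * Real.log k - k * Real.log u) := by
  rw [Real.exp_le_exp]
  have h := Real.log_le_sub_one_of_pos (div_pos hu hk)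
  rw [Real.log_div hu.ne' hk.ne'] at h
  have h2 := mul_le_mul_of_nonneg_left h hk.le
  have h3 : k * (u / k - 1) = u - k := by field_simp
  linarith

/-- The diversity of a single log-normal entry. The integrand is bounded by a negative moment of
order proportional to `log ρ`, which the Gaussian moment generating function evaluates. -/
theorem exists_integral_exp_neg_logNormal_le (m : ℝ) {σ b : ℝ} (hσ : 0 < σ) (hb : 0 < b) :
    ∃ C : ℝ, ∀ ρ : ℝ, Real.exp 1 ≤ ρ →
      ∫ h, Real.exp (-(b * ρ * h ^ 2)) ∂(logNormal m σ) ≤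
        Real.exp (-((σ ^ 2)⁻¹ / 8) * Real.log ρ ^ 2 + C * (Real.log ρ * √(Real.log ρ))) := by
  -- The exponent `-k * L + 2 * σ ^ 2 * k ^ 2` obtained from the order `k` is least at
  -- `k = L / (4 * σ ^ 2)`; the factor `k ^ k` costs only `O(L log L)`.
  set c : ℝ := (4 * σ ^ 2)⁻¹ with hc
  have hcpos : 0 < c := by positivity
  set R := c * (Real.log c - Real.log b - 2 * m) with hR
  refine ⟨2 * c + |R|, fun ρ hρ => ?_⟩
  have hρ0 : 0 < ρ := (Real.exp_pos 1).trans_le hρ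
  have hL := one_le_log_of_exp_one_le hρ
  have hL' := le_mul_sqrt_self hL
  set L := Real.log ρ with hLdef
  set k := c * L with hk
  have hkpos : 0 < k := by positivity
  have hcoe : ((σ ^ 2).toNNReal : ℝ) = σ ^ 2 := Real.coe_toNNReal _ (sq_nonneg σ)
  set v := (σ ^ 2).toNNReal with hv
  rw [logNormal, integral_map Real.measurable_exp.aemeasurable
    (by fun_prop : Continuous fun h : ℝ => Real.exp (-(b * ρ * h ^ 2))).aestronglyMeasurable]
  calc ∫ z, Real.exp (-(b * ρ * Real.exp z ^ 2)) ∂(gaussianReal m v)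
      ≤ ∫ z, Real.exp (k * Real.log k - k * (Real.log b + L)) * Real.exp ((-2 * k) * z)
          ∂(gaussianReal m v) := by
        refine integral_mono_of_nonneg (ae_of_all _ fun _ => (Real.exp_pos _).le)
          ((integrable_exp_mul_gaussianReal _).const_mul _) (ae_of_all _ fun z => ?_)
        refine (exp_neg_le_exp_mul_log hkpos (by positivity)).trans_eq ?_
        beta_reduce
        rw [← Real.exp_add, Real.log_mul (x := b * ρ) (by positivity) (by positivity),
          Real.log_mul hb.ne' hρ0.ne', Real.log_pow, Real.log_exp]
        push_cast
        congr 1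
        ring
    _ = Real.exp (k * Real.log k - k * (Real.log b + L)) *
          Real.exp (m * (-2 * k) + v * (-2 * k) ^ 2 / 2) := by
        rw [integral_const_mul]
        congr 1
        exact congrFun (mgf_id_gaussianReal (μ := m) (v := v)) (-2 * k)
    _ ≤ _ := by
        rw [← Real.exp_add, Real.exp_le_exp, hcoe, hk, Real.log_mul hcpos.ne' (by positivity)]
        have h1 : σ ^ 2 * (-2 * (c * L)) ^ 2 / 2 = c * L ^ 2 / 2 := by
          rw [hc]; field_simp; ring
        have h2 : (σ ^ 2)⁻¹ / 8 = c / 2 := by rw [hc]; field_simp; ring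
        rw [h1, h2]
        have h3 : c * L * Real.log L ≤ c * L * (2 * √L) := by
          gcongr
          exact log_le_two_mul_sqrt (by linarith)
        have h4 : R * L ≤ |R| * (L * √L) :=
          mul_le_mul (le_abs_self R) hL' (by linarith) (abs_nonneg R)
        have h5 : R * L = c * L * Real.log c - c * L * Real.log b - 2 * m * (c * L) := by
          rw [hR]; ring
        linarith

/-! ### The conditional pairwise error probability -/

variable {M N : ℕ}

instance isProbabilityMeasure_noiseLaw (M : ℕ) (v : ℝ≥0) : IsProbabilityMeasure (noiseLaw M v) := by
  unfold noiseLaw; infer_instance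


theorem signal_apply (P : ℝ) (H : Fin M → Fin N → ℝ) (x : Fin N → ℝ) (i : Fin M) :
    signal P H x i = 1 / P * ∑ j, H i j * x j := by
  simp [signal, Matrix.mulVec, dotProduct]

theorem signal_sub (P : ℝ) (H : Fin M → Fin N → ℝ) (x x' : Fin N → ℝ) :
    signal P H (x' - x) = signal P H x' - signal P H x := by
  rw [signal, signal, signal, Matrix.mulVec_sub, smul_sub]

/-- Maximum likelihood detection is minimum distance detection. -/
theorem likelihood_le_likelihood_iff (P : ℝ) {v : ℝ≥0} (hv : v ≠ 0) (H : Fin M → Fin N → ℝ)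
    (x x' : Fin N → ℝ) (n : Fin M → ℝ) :
    likelihood P v H x (signal P H x + n) ≤ likelihood P v H x' (signal P H x + n) ↔
      ∑ i, signal P H (x' - x) i ^ 2 ≤ 2 * ∑ i, n i * signal P H (x' - x) i := by
  have hv0 : (0 : ℝ) < v := by positivity
  simp only [likelihood, gaussianPDFReal, Finset.prod_mul_distrib, ← Real.exp_sum]
  rw [mul_le_mul_iff_right₀ (by positivity), Real.exp_le_exp, ← Finset.sum_div, ← Finset.sum_div,
    div_le_div_iff_of_pos_right (by positivity), ← sub_nonneg, ← sub_nonneg (b := ∑ i, _ ^ 2),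
    ← Finset.sum_sub_distrib, Finset.mul_sum, ← Finset.sum_sub_distrib]
  refine Iff.of_eq (congrArg _ (Finset.sum_congr rfl fun i _ => ?_))
  rw [signal_sub]
  simp only [Pi.add_apply, Pi.sub_apply]
  ring

theorem condPEP_eq (P : ℝ) {v : ℝ≥0} (hv : v ≠ 0) (H : Fin M → Fin N → ℝ) (x x' : Fin N → ℝ) :
    condPEP P v H x x' = (noiseLaw M v).real
      {n | ∑ i, signal P H (x' - x) i ^ 2 ≤ 2 * ∑ i, n i * signal P H (x' - x) i} := by
  simp only [condPEP, likelihood_le_likelihood_iff P hv]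

theorem condPEP_nonneg (P : ℝ) (v : ℝ≥0) (H : Fin M → Fin N → ℝ) (x x' : Fin N → ℝ) :
    0 ≤ condPEP P v H x x' := measureReal_nonneg

/-- Measurability in the channel matrix; without it, the Bochner integral that defines `pep` would
be zero by convention. -/
theorem measurable_condPEP (P : ℝ) {v : ℝ≥0} (hv : v ≠ 0) (x x' : Fin N → ℝ) :
    Measurable fun H : Fin M → Fin N → ℝ => condPEP P v H x x' := by
  simp only [condPEP_eq P hv, signal_apply]
  refine (measurable_measure_prodMk_left (ν := noiseLaw M v)
    (s := {q : (Fin M → Fin N → ℝ) × (Fin M → ℝ) |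
      ∑ i, (1 / P * ∑ j, q.1 i j * (x' - x) j) ^ 2 ≤
        2 * ∑ i, q.2 i * (1 / P * ∑ j, q.1 i j * (x' - x) j)}) ?_).ennreal_toReal
  exact measurableSet_le (by fun_prop) (by fun_prop)

theorem integrable_condPEP (P : ℝ) {v : ℝ≥0} (hv : v ≠ 0) (x x' : Fin N → ℝ)
    (μ : Measure (Fin M → Fin N → ℝ)) [IsFiniteMeasure μ] :
    Integrable (fun H => condPEP P v H x x') μ :=
  .of_bound (measurable_condPEP P hv x x').aestronglyMeasurable 1 (ae_of_all _ fun H => by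
    rw [Real.norm_of_nonneg (condPEP_nonneg P v H x x')]
    exact measureReal_le_one)

/-- The Chernoff bound on the conditional pairwise error probability, at the optimal parameter
`1 / (2 v)`. -/
theorem condPEP_le (P : ℝ) {v : ℝ≥0} (hv : v ≠ 0) (H : Fin M → Fin N → ℝ) (x x' : Fin N → ℝ) :
    condPEP P v H x x' ≤ Real.exp (-(∑ i, signal P H (x' - x) i ^ 2) / (8 * v)) := by
  rw [condPEP_eq P hv]
  generalize signal P H (x' - x) = d
  have hv0 : (0 : ℝ) < v := by positivity
  set t : ℝ := (2 * v)⁻¹ with ht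
  have ht0 : 0 ≤ t := by positivity
  have hprod : ∀ n : Fin M → ℝ,
      Real.exp (t * ∑ i, n i * d i) = ∏ i, Real.exp (t * d i * n i) := fun n => by
    rw [← Real.exp_sum, Finset.mul_sum]
    exact congrArg _ (Finset.sum_congr rfl fun i _ => by ring)
  have hint : Integrable (fun n : Fin M → ℝ => Real.exp (t * ∑ i, n i * d i)) (noiseLaw M v) := by
    simp only [hprod]
    exact Integrable.fintype_prod (f := fun i y => Real.exp (t * d i * y))
      fun i => integrable_exp_mul_gaussianReal _
  have hmgf : mgf (fun n : Fin M → ℝ => ∑ i, n i * d i) (noiseLaw M v) t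
      = Real.exp ((∑ i, d i ^ 2) / (8 * v)) := by
    simp only [mgf, hprod]
    rw [noiseLaw, integral_fintype_prod_eq_prod (f := fun i y => Real.exp (t * d i * y)),
      Finset.sum_div, Real.exp_sum]
    refine Finset.prod_congr rfl fun i _ => ?_
    refine (congrFun (mgf_id_gaussianReal (μ := 0) (v := v)) (t * d i)).trans (congrArg _ ?_)
    rw [ht]
    field_simp
    ring
  have h := measure_ge_le_exp_mul_mgf ((∑ i, d i ^ 2) / 2) ht0 hint
  rw [hmgf, ← Real.exp_add] at h
  refine le_trans (measureReal_mono fun n hn => ?_) (h.trans (le_of_eq (congrArg _ ?_)))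
  · have : ∑ i, d i ^ 2 ≤ 2 * ∑ i, n i * d i := hn
    simp only [Set.mem_ofPred_eq]
    linarith
  · rw [ht]; field_simp; ring

theorem gaussianReal_zero_real_Ici (v : ℝ≥0) (hv : v ≠ 0) (c : ℝ) :
    (gaussianReal 0 v).real (Set.Ici (c * √v)) = (gaussianReal 0 1).real (Set.Ici c) := by
  have hs : (0 : ℝ) < √v := by positivity
  have h := gaussianReal_map_const_mul (μ := 0) (v := 1) √(v : ℝ)
  have hv' : NNReal.mk (√(v : ℝ) ^ 2) (sq_nonneg _) * 1 = v := by
    ext; simp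
  rw [mul_zero, hv'] at h
  rw [← h, map_measureReal_apply (by fun_prop) measurableSet_Ici]
  congr 1
  ext z
  simp only [Set.mem_preimage, Set.mem_Ici]
  rw [mul_comm c, mul_le_mul_iff_right₀ hs]

theorem gaussianReal_one_real_Ici_pos (c : ℝ) : 0 < (gaussianReal 0 1).real (Set.Ici c) := by
  rw [measureReal_def, ENNReal.toReal_pos_iff]
  refine ⟨pos_iff_ne_zero.2 fun h => ?_, measure_lt_top _ _⟩
  have := gaussianReal_absolutelyContinuous' 0 one_ne_zero h
  simp at this

theorem le_gaussianReal_real_halfLine {v : ℝ≥0} (hv : v ≠ 0) (c d : ℝ) :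
    (gaussianReal 0 1).real (Set.Ici c) ≤
      (gaussianReal 0 v).real {z | c * √v * |d| ≤ z * d} := by
  rw [← gaussianReal_zero_real_Ici v hv]
  rcases lt_trichotomy d 0 with hd | rfl | hd
  · have h := gaussianReal_map_neg (μ := 0) (v := v)
    rw [neg_zero] at h
    conv_lhs => rw [← h, map_measureReal_apply measurable_neg measurableSet_Ici]
    refine measureReal_mono fun z hz => ?_
    simp only [Set.mem_preimage, Set.mem_Ici] at hz
    simp only [Set.mem_ofPred_eq, abs_of_neg hd]
    nlinarith
  · simp
  · refine measureReal_mono fun z hz => ?_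
    simp only [Set.mem_Ici] at hz
    simp only [Set.mem_ofPred_eq, abs_of_pos hd]
    nlinarith

/-- If the two noiseless signals differ by at most `K` noise standard deviations in each component,
the conditional pairwise error probability is at least a positive constant that does not depend on
the noise variance: the error event contains the product of the half-lines
`K / 2 * √v * |d i| ≤ n i * d i`. -/
theorem le_condPEP (P : ℝ) {v : ℝ≥0} (hv : v ≠ 0) (H : Fin M → Fin N → ℝ) (x x' : Fin N → ℝ)
    {K : ℝ} (hK : ∀ i, |signal P H (x' - x) i| ≤ K * √v) :
    (gaussianReal 0 1).real (Set.Ici (K / 2)) ^ M ≤ condPEP P v H x x' := by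
  rw [condPEP_eq P hv]
  generalize signal P H (x' - x) = d at *
  calc (gaussianReal 0 1).real (Set.Ici (K / 2)) ^ M
      ≤ ∏ i : Fin M, (gaussianReal 0 v).real {z | K / 2 * √v * |d i| ≤ z * d i} := by
        rw [← Fin.prod_const]
        exact Finset.prod_le_prod (fun _ _ => measureReal_nonneg)
          fun i _ => le_gaussianReal_real_halfLine hv _ _
    _ = (noiseLaw M v).real (Set.univ.pi fun i => {z | K / 2 * √v * |d i| ≤ z * d i}) := by
        simp only [noiseLaw, measureReal_def, Measure.pi_pi, ENNReal.toReal_prod]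
    _ ≤ _ := by
        refine measureReal_mono fun n hn => ?_
        simp only [Set.mem_ofPred_eq, Finset.mul_sum]
        refine Finset.sum_le_sum fun i _ => ?_
        have h1 : K / 2 * √v * |d i| ≤ n i * d i := hn i (Set.mem_univ i)
        have h2 : |d i| * |d i| ≤ K * √v * |d i| :=
          mul_le_mul_of_nonneg_right (hK i) (abs_nonneg _)
        rw [← sq, sq_abs] at h2
        linarith

/-! ### Averaging over the fading -/

theorem coe_noiseVar (N : ℕ) {ρ : ℝ} (hρ : 0 < ρ) : (noiseVar N ρ : ℝ) = 1 / (N * ρ) :=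
  Real.coe_toNNReal _ (by positivity)

theorem noiseVar_ne_zero (hN : 0 < N) {ρ : ℝ} (hρ : 0 < ρ) : noiseVar N ρ ≠ 0 := by
  have hN' : (0 : ℝ) < N := Nat.cast_pos.2 hN
  exact (Real.toNNReal_pos.2 (by positivity)).ne'

theorem ae_channelLaw_nonneg (m σ : Fin M → Fin N → ℝ) :
    ∀ᵐ H ∂(channelLaw m σ), ∀ i j, 0 ≤ H i j := by
  have h1 : ∀ i j, ∀ᵐ h ∂(logNormal (m i j) (σ i j)), 0 ≤ h := fun i j =>
    (ae_map_iff Real.measurable_exp.aemeasurable measurableSet_Ici).2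
      (ae_of_all _ fun z => (Real.exp_pos z).le)
  refine ae_all_iff.2 fun i => ae_all_iff.2 fun j => ?_
  have h2 : ∀ᵐ r ∂(Measure.pi fun j => logNormal (m i j) (σ i j)), 0 ≤ r j :=
    Measure.tendsto_eval_ae_ae.eventually (h1 i j)
  exact (Measure.tendsto_eval_ae_ae
    (μ := fun i => Measure.pi fun j => logNormal (m i j) (σ i j))).eventually h2

/-- The only use of unipolarity: with nonnegative channel gains, the terms of the inner product
do not cancel. -/
theorem sum_mul_sq_le_sq_sum_mul {e h : Fin N → ℝ} (he : IsUnipolar e) (hh : ∀ j, 0 ≤ h j) :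
    ∑ j, (h j * e j) ^ 2 ≤ (∑ j, h j * e j) ^ 2 := by
  rcases he with he | he
  · exact Finset.sum_sq_le_sq_sum_of_nonneg fun j _ => mul_nonneg (hh j) (he j)
  · have := Finset.sum_sq_le_sq_sum_of_nonneg (s := Finset.univ) (f := fun j => -(h j * e j))
      fun j _ => neg_nonneg.2 (mul_nonpos_of_nonneg_of_nonpos (hh j) (he j))
    simpa using this

theorem condPEP_le_of_isUnipolar (hN : 0 < N) (P : ℝ) {ρ : ℝ} (hρ : 0 < ρ)
    {H : Fin M → Fin N → ℝ} (hH : ∀ i j, 0 ≤ H i j) {x x' : Fin N → ℝ}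
    (he : IsUnipolar (x' - x)) :
    condPEP P (noiseVar N ρ) H x x' ≤
      ∏ i, ∏ j, Real.exp (-(N * (x' - x) j ^ 2 / (8 * P ^ 2) * ρ * H i j ^ 2)) := by
  refine (condPEP_le P (noiseVar_ne_zero hN hρ) H x x').trans ?_
  simp only [← Real.exp_sum, Finset.sum_neg_distrib, neg_div, Real.exp_le_exp, neg_le_neg_iff,
    Finset.sum_div, coe_noiseVar N hρ, signal_apply]
  refine Finset.sum_le_sum fun i _ => ?_
  have hN' : (0 : ℝ) < N := Nat.cast_pos.2 hN
  calc ∑ j, N * (x' - x) j ^ 2 / (8 * P ^ 2) * ρ * H i j ^ 2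
      = N * ρ / (8 * P ^ 2) * ∑ j, (H i j * (x' - x) j) ^ 2 := by
        rw [Finset.mul_sum]
        exact Finset.sum_congr rfl fun j _ => by ring
    _ ≤ N * ρ / (8 * P ^ 2) * (∑ j, H i j * (x' - x) j) ^ 2 := by
        gcongr
        exact sum_mul_sq_le_sq_sum_mul he (hH i)
    _ = _ := by field_simp

theorem integral_condPEP_le_prod (hN : 0 < N) (m σ : Fin M → Fin N → ℝ) (P : ℝ) {ρ : ℝ}
    (hρ : 0 < ρ) {x x' : Fin N → ℝ} (he : IsUnipolar (x' - x)) :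
    ∫ H, condPEP P (noiseVar N ρ) H x x' ∂(channelLaw m σ) ≤
      ∏ i, ∏ j, ∫ h, Real.exp (-(N * (x' - x) j ^ 2 / (8 * P ^ 2) * ρ * h ^ 2))
        ∂(logNormal (m i j) (σ i j)) := by
  set b : Fin N → ℝ := fun j => N * (x' - x) j ^ 2 / (8 * P ^ 2) * ρ with hb
  have hb0 : ∀ j, 0 ≤ b j := fun j => by positivity
  calc ∫ H, condPEP P (noiseVar N ρ) H x x' ∂(channelLaw m σ)
      ≤ ∫ H, ∏ i, ∏ j, Real.exp (-(b j * H i j ^ 2)) ∂(channelLaw m σ) := by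
        refine integral_mono_of_nonneg (ae_of_all _ fun H => condPEP_nonneg _ _ _ _ _) ?_ ?_
        · refine .of_bound (by fun_prop : Measurable _).aestronglyMeasurable 1 (ae_of_all _ fun H => ?_)
          simp only [← Real.exp_sum]
          rw [Real.norm_of_nonneg (Real.exp_pos _).le, Real.exp_le_one_iff]
          refine Finset.sum_nonpos fun i _ => Finset.sum_nonpos fun j _ => ?_
          have := mul_nonneg (hb0 j) (sq_nonneg (H i j))
          linarith
        · filter_upwards [ae_channelLaw_nonneg m σ] with H hH
          exact condPEP_le_of_isUnipolar hN P hρ hH he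
    _ = _ := by
        rw [channelLaw, integral_fintype_prod_eq_prod
          (f := fun (_ : Fin M) (r : Fin N → ℝ) => ∏ j, Real.exp (-(b j * r j ^ 2)))]
        refine Finset.prod_congr rfl fun i _ => ?_
        rw [integral_fintype_prod_eq_prod (f := fun j h => Real.exp (-(b j * h ^ 2)))]

/-- If each column of `H` is within `ρ ^ (-1/2)` of a vector of equal entries `a j`, with `a`
orthogonal to `e`, then the signal of `e` is of the order of the noise standard deviation. -/
theorem abs_signal_le {P : ℝ} (hP : 0 < P) {ρ : ℝ} (hρ : 0 < ρ) (hN : 0 < N) {a e : Fin N → ℝ}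
    (hae : ∑ j, a j * e j = 0) {H : Fin M → Fin N → ℝ}
    (hH : ∀ i j, H i j ∈ Set.Icc (a j) (a j + (√ρ)⁻¹)) (i : Fin M) :
    |signal P H e i| ≤ √N * (∑ j, |e j|) / P * √(noiseVar N ρ) := by
  have hN' : (0 : ℝ) < N := Nat.cast_pos.2 hN
  have h1 : ∑ j, H i j * e j = ∑ j, (H i j - a j) * e j := by
    simp only [sub_mul, Finset.sum_sub_distrib, hae, sub_zero]
  have h2 : |∑ j, (H i j - a j) * e j| ≤ (√ρ)⁻¹ * ∑ j, |e j| := by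
    refine (Finset.abs_sum_le_sum_abs _ _).trans ?_
    rw [Finset.mul_sum]
    refine Finset.sum_le_sum fun j _ => ?_
    rw [abs_mul, abs_of_nonneg (sub_nonneg.2 (hH i j).1)]
    exact mul_le_mul_of_nonneg_right (sub_le_iff_le_add'.2 (hH i j).2) (abs_nonneg _)
  have h3 : √(noiseVar N ρ : ℝ) = (√N)⁻¹ * (√ρ)⁻¹ := by
    rw [coe_noiseVar N hρ, one_div, Real.sqrt_inv, Real.sqrt_mul hN'.le, mul_inv]
  rw [signal_apply, h1, abs_mul, abs_of_pos (by positivity : 0 < 1 / P), h3]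
  calc 1 / P * |∑ j, (H i j - a j) * e j| ≤ 1 / P * ((√ρ)⁻¹ * ∑ j, |e j|) := by gcongr
    _ = _ := by field_simp

/-- The entries of the channel matrix are independent. -/
theorem channelLaw_real_box (m σ : Fin M → Fin N → ℝ) (B : Fin N → Set ℝ) :
    (channelLaw m σ).real (Set.univ.pi fun _ => Set.univ.pi B) =
      ∏ i, ∏ j, (logNormal (m i j) (σ i j)).real (B j) := by
  simp only [channelLaw, measureReal_def, Measure.pi_pi, ENNReal.toReal_prod]

theorem exists_mul_prod_le_integral_condPEP (hN : 0 < N) (m σ : Fin M → Fin N → ℝ) {P : ℝ}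
    (hP : 0 < P) {x x' a : Fin N → ℝ} (ha : ∑ j, a j * (x' - x) j = 0) :
    ∃ q : ℝ, 0 < q ∧ ∀ ρ : ℝ, 0 < ρ →
      q * ∏ i, ∏ j, (logNormal (m i j) (σ i j)).real (Set.Icc (a j) (a j + (√ρ)⁻¹)) ≤
        ∫ H, condPEP P (noiseVar N ρ) H x x' ∂(channelLaw m σ) := by
  set K := √N * (∑ j, |(x' - x) j|) / P with hK
  refine ⟨(gaussianReal 0 1).real (Set.Ici (K / 2)) ^ M,
    pow_pos (gaussianReal_one_real_Ici_pos _) _, fun ρ hρ => ?_⟩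
  have hv := noiseVar_ne_zero hN hρ
  set B : Set (Fin M → Fin N → ℝ) :=
    Set.univ.pi fun _ => Set.univ.pi fun j => Set.Icc (a j) (a j + (√ρ)⁻¹) with hB
  have hBm : MeasurableSet B :=
    .univ_pi fun _ => .univ_pi fun _ => measurableSet_Icc
  have hint := integrable_condPEP P hv x x' (channelLaw m σ)
  calc _ = ∫ _ in B, (gaussianReal 0 1).real (Set.Ici (K / 2)) ^ M ∂(channelLaw m σ) := by
        rw [setIntegral_const, smul_eq_mul, hB, channelLaw_real_box, mul_comm]
    _ ≤ ∫ H in B, condPEP P (noiseVar N ρ) H x x' ∂(channelLaw m σ) := by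
        refine setIntegral_mono_on (integrableOn_const (measure_ne_top _ _))
          hint.integrableOn hBm fun H hH => ?_
        exact le_condPEP P hv H x x' (abs_signal_le hP hρ hN ha
          fun i j => hH i (Set.mem_univ i) j (Set.mem_univ j))
    _ ≤ _ := setIntegral_le_integral hint (ae_of_all _ fun H => condPEP_nonneg _ _ _ _ _)

/-! ### The diversity gain of a function between exponential bounds -/

/-- The logarithms of `ρ / ln² ρ` and of `ρ` are equivalent. -/
theorem tendsto_log_div_log_sq_div_log :
    Tendsto (fun ρ => Real.log (ρ / Real.log ρ ^ 2) / Real.log ρ) atTop (𝓝 1) := by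
  have h1 : Tendsto (fun ρ => Real.log (Real.log ρ) / Real.log ρ) atTop (𝓝 0) :=
    (Real.isLittleO_log_id_atTop.tendsto_div_nhds_zero).comp Real.tendsto_log_atTop
  have h2 := (h1.const_mul 2).const_sub 1
  rw [mul_zero, sub_zero] at h2
  refine h2.congr' ?_
  filter_upwards [eventually_ge_atTop (Real.exp 1)] with ρ hρ
  have hL := one_le_log_of_exp_one_le hρ
  have hρ0 : 0 < ρ := (Real.exp_pos 1).trans_le hρ
  rw [Real.log_div hρ0.ne' (by positivity), Real.log_pow]
  push_cast
  field_simp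

theorem tendsto_div_log_sq (g C : ℝ) :
    Tendsto (fun ρ => (g * Real.log ρ ^ 2 + C * (Real.log ρ * √(Real.log ρ))) /
      Real.log (ρ / Real.log ρ ^ 2) ^ 2) atTop (𝓝 g) := by
  have h1 : Tendsto (fun ρ => (√(Real.log ρ))⁻¹) atTop (𝓝 0) :=
    tendsto_inv_atTop_zero.comp (Real.tendsto_sqrt_atTop.comp Real.tendsto_log_atTop)
  have h2 := ((h1.const_mul C).const_add g).div (tendsto_log_div_log_sq_div_log.pow 2) (by simp)
  rw [mul_zero, add_zero, one_pow, div_one] at h2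
  refine h2.congr' ?_
  filter_upwards [eventually_ge_atTop (Real.exp 1)] with ρ hρ
  have hL := one_le_log_of_exp_one_le hρ
  simp only [Pi.div_apply]
  have hs : 0 < √(Real.log ρ) := Real.sqrt_pos.2 (by linarith)
  have h3 : √(Real.log ρ) * √(Real.log ρ) = Real.log ρ := Real.mul_self_sqrt (by linarith)
  generalize Real.log (ρ / Real.log ρ ^ 2) = Λ
  have h4 : g * Real.log ρ ^ 2 + C * (Real.log ρ * √(Real.log ρ)) =
      (g + C * (√(Real.log ρ))⁻¹) * Real.log ρ ^ 2 := by
    generalize √(Real.log ρ) = s at *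
    rw [← h3]
    field_simp
  rw [h4, div_pow, div_div_eq_mul_div]

theorem eventually_gain_le {p : ℝ → ℝ} {g C : ℝ} (hp : ∀ ρ, Real.exp 1 ≤ ρ →
      Real.exp (-(g / 8) * Real.log ρ ^ 2 - C * (Real.log ρ * √(Real.log ρ))) ≤ p ρ) :
    ∀ᶠ ρ in atTop, -8 * Real.log (p ρ) / Real.log (ρ / Real.log ρ ^ 2) ^ 2 ≤
      (g * Real.log ρ ^ 2 + 8 * C * (Real.log ρ * √(Real.log ρ))) /
        Real.log (ρ / Real.log ρ ^ 2) ^ 2 := by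
  filter_upwards [eventually_ge_atTop (Real.exp 1)] with ρ hρ
  have h := (Real.le_log_iff_exp_le ((Real.exp_pos _).trans_le (hp ρ hρ))).2 (hp ρ hρ)
  gcongr
  linarith

theorem HasLargeScaleDiversityGain.le {p : ℝ → ℝ} {G g C : ℝ}
    (h : HasLargeScaleDiversityGain p G) (hp : ∀ ρ, Real.exp 1 ≤ ρ →
      Real.exp (-(g / 8) * Real.log ρ ^ 2 - C * (Real.log ρ * √(Real.log ρ))) ≤ p ρ) : G ≤ g :=
  le_of_tendsto_of_tendsto h (tendsto_div_log_sq g (8 * C)) (eventually_gain_le hp)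

theorem hasLargeScaleDiversityGain_of_bounds {p : ℝ → ℝ} {g C C' : ℝ}
    (hp : ∀ ρ, Real.exp 1 ≤ ρ →
      Real.exp (-(g / 8) * Real.log ρ ^ 2 - C * (Real.log ρ * √(Real.log ρ))) ≤ p ρ)
    (hp' : ∀ ρ, Real.exp 1 ≤ ρ →
      p ρ ≤ Real.exp (-(g / 8) * Real.log ρ ^ 2 + C' * (Real.log ρ * √(Real.log ρ)))) :
    HasLargeScaleDiversityGain p g := by
  refine tendsto_of_tendsto_of_tendsto_of_le_of_le' (tendsto_div_log_sq g (-(8 * C')))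
    (tendsto_div_log_sq g (8 * C)) ?_ (eventually_gain_le hp)
  filter_upwards [eventually_ge_atTop (Real.exp 1)] with ρ hρ
  have h := (Real.log_le_iff_le_exp ((Real.exp_pos _).trans_le (hp ρ hρ))).2 (hp' ρ hρ)
  gcongr
  linarith

/-! ### The pairwise error probability of a code -/

variable {S : Type*} [Fintype S]

theorem opticalPower_pos {F : S → Fin N → ℝ} (hF_nonneg : ∀ s j, 0 ≤ F s j)
    (hF_inj : Function.Injective F) {s s' : S} (hs : s ≠ s') : 0 < opticalPower F := by
  obtain ⟨t, ht⟩ : ∃ t, F t ≠ 0 := by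
    by_contra! h
    exact hs (hF_inj ((h s).trans (h s').symm))
  obtain ⟨j, hj⟩ := Function.ne_iff.1 ht
  have : Nonempty S := ⟨s⟩
  refine div_pos ?_ (Nat.cast_pos.2 Fintype.card_pos)
  exact Finset.sum_pos' (fun t _ => Finset.sum_nonneg fun j _ => hF_nonneg t j)
    ⟨t, Finset.mem_univ t, Finset.sum_pos' (fun j _ => hF_nonneg t j)
      ⟨j, Finset.mem_univ j, (hF_nonneg t j).lt_of_ne' hj⟩⟩

theorem prod_prod_exp_eq (g C : Fin M → Fin N → ℝ) (x y : ℝ) :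
    ∏ i, ∏ j, Real.exp (-(g i j / 8) * x + C i j * y) =
      Real.exp (-((∑ i, ∑ j, g i j) / 8) * x + (∑ i, ∑ j, C i j) * y) := by
  simp only [← Real.exp_sum, Finset.sum_add_distrib, ← Finset.sum_mul, Finset.sum_neg_distrib,
    Finset.sum_div]

/-- Each nonnegative vector `a` orthogonal to the error vector bounds the diversity gain above by
the terms of `Ω` from the columns in which `a` vanishes. -/
theorem exists_exp_le_pep (hN : 0 < N) (m : Fin M → Fin N → ℝ) {σ : Fin M → Fin N → ℝ}
    (hσ : ∀ i j, 0 < σ i j) {F : S → Fin N → ℝ} (hP : 0 < opticalPower F) {s s' : S}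
    {a : Fin N → ℝ} (ha : ∀ j, 0 ≤ a j) (hae : ∑ j, a j * (F s' - F s) j = 0) :
    ∃ C : ℝ, ∀ ρ : ℝ, Real.exp 1 ≤ ρ →
      Real.exp (-((∑ i, ∑ j, if a j = 0 then (σ i j ^ 2)⁻¹ else 0) / 8) * Real.log ρ ^ 2
        - C * (Real.log ρ * √(Real.log ρ))) ≤ pep m σ F s s' ρ := by
  choose C hC using fun i j => exists_exp_le_logNormal_Icc (m i j) (hσ i j) (ha j)
  obtain ⟨q, hq, hle⟩ := exists_mul_prod_le_integral_condPEP hN m σ hP hae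
  refine ⟨|Real.log q| + ∑ i, ∑ j, C i j, fun ρ hρ => ?_⟩
  have hL := one_le_log_of_exp_one_le hρ
  refine le_trans ?_ (hle ρ ((Real.exp_pos 1).trans_le hρ))
  calc _ ≤ q * ∏ i, ∏ j, Real.exp (-((if a j = 0 then (σ i j ^ 2)⁻¹ else 0) / 8) *
          Real.log ρ ^ 2 + -C i j * (Real.log ρ * √(Real.log ρ))) := by
        rw [prod_prod_exp_eq, ← Real.exp_log hq, ← Real.exp_add, Real.exp_log hq, Real.exp_le_exp]
        have h := (neg_le_abs (Real.log q)).trans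
          (le_mul_of_one_le_right (abs_nonneg _) (hL.trans (le_mul_sqrt_self hL)))
        simp only [Finset.sum_neg_distrib]
        linarith
    _ ≤ _ := by
        gcongr with i _ j _
        rw [neg_mul (C i j), ← sub_eq_add_neg]
        exact hC i j ρ hρ

theorem exists_pep_le_exp (hN : 0 < N) (m : Fin M → Fin N → ℝ) {σ : Fin M → Fin N → ℝ}
    (hσ : ∀ i j, 0 < σ i j) {F : S → Fin N → ℝ} (hP : 0 < opticalPower F) {s s' : S}
    (he : IsUnipolar (F s' - F s)) (he0 : ∀ j, (F s' - F s) j ≠ 0) :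
    ∃ C : ℝ, ∀ ρ : ℝ, Real.exp 1 ≤ ρ →
      pep m σ F s s' ρ ≤ Real.exp (-(totalDiversity σ / 8) * Real.log ρ ^ 2
        + C * (Real.log ρ * √(Real.log ρ))) := by
  have hN' : (0 : ℝ) < N := Nat.cast_pos.2 hN
  have hb : ∀ j, 0 < N * (F s' - F s) j ^ 2 / (8 * opticalPower F ^ 2) := fun j => by
    have := he0 j
    positivity
  choose C hC using fun i j => exists_integral_exp_neg_logNormal_le (m i j) (hσ i j) (hb j)
  refine ⟨∑ i, ∑ j, C i j, fun ρ hρ => ?_⟩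
  refine (integral_condPEP_le_prod hN m σ _ ((Real.exp_pos 1).trans_le hρ) he).trans ?_
  rw [totalDiversity, ← prod_prod_exp_eq]
  refine Finset.prod_le_prod (fun i _ => Finset.prod_nonneg fun j _ =>
    integral_nonneg fun _ => (Real.exp_pos _).le) fun i _ => ?_
  exact Finset.prod_le_prod (fun j _ => integral_nonneg fun _ => (Real.exp_pos _).le)
    fun j _ => hC i j ρ hρ

/-- A vector with a zero entry or with two entries of opposite signs is orthogonal to some nonzero
nonnegative vector. -/
theorem exists_nonneg_sum_mul_eq_zero {e : Fin N → ℝ}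
    (he : ¬(IsUnipolar e ∧ ∀ j, e j ≠ 0)) :
    ∃ a : Fin N → ℝ, (∀ j, 0 ≤ a j) ∧ (∃ j, a j ≠ 0) ∧ ∑ j, a j * e j = 0 := by
  have hs : ∀ (k : Fin N) (c : ℝ), 0 ≤ c → ∀ j, 0 ≤ (Pi.single k c : Fin N → ℝ) j :=
    fun k c hc => (Pi.single_nonneg.2 hc : (0 : Fin N → ℝ) ≤ Pi.single k c)
  by_cases h0 : ∃ j, e j = 0
  · obtain ⟨j, hj⟩ := h0
    exact ⟨Pi.single j 1, hs j 1 zero_le_one, ⟨j, by simp⟩,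
      by simp [Pi.single_apply, hj]⟩
  · push Not at h0
    have hu : ¬IsUnipolar e := fun h => he ⟨h, h0⟩
    simp only [IsUnipolar, not_or, not_forall, not_le] at hu
    obtain ⟨⟨k, hk⟩, l, hl⟩ := hu
    have hkl : k ≠ l := by rintro rfl; linarith
    refine ⟨Pi.single k (e l) + Pi.single l (-e k), fun j => ?_, ⟨k, ?_⟩, ?_⟩
    · exact add_nonneg (hs k _ hl.le j) (hs l _ (neg_nonneg.2 hk.le) j)
    · simp [hkl, hl.ne']
    · simp [add_mul, Finset.sum_add_distrib, Pi.single_apply]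
      ring

/-- A column in which `a` does not vanish contributes `M ≥ 1` positive terms to `Ω` that the sum on
the left lacks. -/
theorem sum_ite_lt_totalDiversity (hM : 0 < M) {σ : Fin M → Fin N → ℝ} (hσ : ∀ i j, 0 < σ i j)
    {a : Fin N → ℝ} (ha : ∃ j, a j ≠ 0) :
    (∑ i, ∑ j, if a j = 0 then (σ i j ^ 2)⁻¹ else 0) < totalDiversity σ := by
  obtain ⟨k, hk⟩ := ha
  have hle : ∀ i j, (if a j = 0 then (σ i j ^ 2)⁻¹ else 0) ≤ (σ i j ^ 2)⁻¹ := fun i j => by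
    split_ifs
    · exact le_rfl
    · positivity
  have : Nonempty (Fin M) := ⟨⟨0, hM⟩⟩
  refine Finset.sum_lt_sum_of_nonempty Finset.univ_nonempty fun i _ =>
    Finset.sum_lt_sum (fun j _ => hle i j) ⟨k, Finset.mem_univ k, ?_⟩
  rw [if_neg hk]
  have := hσ i k
  positivity

theorem hasLargeScaleDiversityGain_pep_iff (hM : 0 < M) (hN : 0 < N) (m : Fin M → Fin N → ℝ)
    {σ : Fin M → Fin N → ℝ} (hσ : ∀ i j, 0 < σ i j) {F : S → Fin N → ℝ}
    (hP : 0 < opticalPower F) (s s' : S) :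
    HasLargeScaleDiversityGain (pep m σ F s s') (totalDiversity σ) ↔
      IsUnipolar (F s' - F s) ∧ ∀ j, (F s' - F s) j ≠ 0 := by
  constructor
  · intro h
    by_contra he
    obtain ⟨a, ha, ha0, hae⟩ := exists_nonneg_sum_mul_eq_zero he
    obtain ⟨C, hC⟩ := exists_exp_le_pep hN m hσ hP ha hae
    exact (h.le hC).not_gt (sum_ite_lt_totalDiversity hM hσ ha0)
  · rintro ⟨he, he0⟩
    obtain ⟨C, hC⟩ := exists_exp_le_pep hN m hσ hP (s := s) (s' := s') (a := 0)
      (fun _ => le_rfl) (by simp)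
    obtain ⟨C', hC'⟩ := exists_pep_le_exp hN m hσ hP he he0
    refine hasLargeScaleDiversityGain_of_bounds (C := C) (fun ρ hρ => ?_) hC'
    simpa [totalDiversity] using hC ρ hρ

theorem isUnipolar_and_ne_zero_iff {e : Fin N → ℝ} :
    (IsUnipolar e ∧ ∀ j, e j ≠ 0) ↔ ∀ i j, 0 < errorMatrix e i j := by
  simp only [errorMatrix, Matrix.vecMulVec_apply]
  constructor
  · rintro ⟨he | he, h0⟩ i j
    · exact mul_pos ((he i).lt_of_ne' (h0 i)) ((he j).lt_of_ne' (h0 j))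
    · exact mul_pos_of_neg_of_neg ((he i).lt_of_ne (h0 i)) ((he j).lt_of_ne (h0 j))
  · intro h
    refine ⟨?_, fun j hj => by simpa [hj] using h j j⟩
    by_contra hu
    simp only [IsUnipolar, not_or, not_forall, not_le] at hu
    obtain ⟨⟨k, hk⟩, l, hl⟩ := hu
    exact (h k l).not_gt (mul_neg_of_neg_of_pos hk hl)

end MIMOOWC

theorem theorem2 {M N : ℕ} (hM : 0 < M) (hN : 0 < N)
    (m σ : Fin M → Fin N → ℝ) (hσ : ∀ i j, 0 < σ i j)
    {S : Type*} [Fintype S] (F : S → Fin N → ℝ)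
    (hF_nonneg : ∀ s j, 0 ≤ F s j) (hF_inj : Function.Injective F) :
    (MIMOOWC.FullLargeScaleDiversity m σ F ↔
      ∀ e ∈ MIMOOWC.errorSet F, MIMOOWC.IsUnipolar e ∧ ∀ j, e j ≠ 0) ∧
    (MIMOOWC.FullLargeScaleDiversity m σ F ↔
      ∀ e ∈ MIMOOWC.errorSet F, ∀ i j, 0 < MIMOOWC.errorMatrix e i j) := by
  simp only [← MIMOOWC.isUnipolar_and_ne_zero_iff, and_self]
  have key : ∀ s s' : S, s ≠ s' →
      (MIMOOWC.HasLargeScaleDiversityGain (MIMOOWC.pep m σ F s s') (MIMOOWC.totalDiversity σ) ↔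
        MIMOOWC.IsUnipolar (F s' - F s) ∧ ∀ j, (F s' - F s) j ≠ 0) := fun s s' hs =>
    MIMOOWC.hasLargeScaleDiversityGain_pep_iff hM hN m hσ
      (MIMOOWC.opticalPower_pos hF_nonneg hF_inj hs) s s'
  constructor
  · rintro h e ⟨-, s, s', hs, rfl⟩
    exact (key s s' hs).1 (h s s' hs)
  · intro h s s' hs
    exact (key s s' hs).2 (h _ ⟨sub_ne_zero.2 fun h' => hs (hF_inj h').symm, s, s', hs, rfl⟩)
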